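/- Let $p,q\ge 0$ be integers, $n=p+q$, and let $\mathcal G_{p,q}$ be the real Clifford algebra with identity $e$ and generators $e_1,\dots,e_n$ satisfying $e_ae_b+e_be_a=2\eta_{ab}e$, where $\eta=\mathrm{diag}(1,\dots,1,-1,\dots,-1)$ has $p$ entries $1$ followed by $q$ entries $-1$. For $A=\{a_1<\dots<a_k\}\subseteq\{1,\dots,n\}$ put $e_A=e_{a_1}\cdots e_{a_k}$ (with $e_\emptyset=e$); the $e_A$ form a basis of $\mathcal G_{p,q}$ and are invertible. For $M=\sum_A m_Ae_A$ with $m_A\in\mathbb R$ let $M^\dagger:=\sum_A m_A(e_A)^{-1}$, and let $\mathrm G\mathcal G_{p,q}=\{U\in\mathcal G_{p,q}: U^\dagger U=e\}$. Define $$d=\begin{cases}2^{n/2},& p-q\equiv 0,2 \pmod 8,\\ 2^{(n+1)/2},& p-q\equiv 1\pmod 8,\\ 2^{(n-1)/2},& p-q\equiv 3,5,7\pmod 8,\\ 2^{(n-2)/2},& p-q\equiv 4,6\pmod 8.\end{cases}$$ Then there is a set $\{e_{B_1},\dots,e_{B_d}\}$ of exactly $d$ basis elements, depending only on $p$ and $q$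 and containing $e$, such that, with $K:=\{\sum_{i=1}^d\lambda_ie_{B_i}:\lambda_i\in\mathbb R\}$, every $M\in\mathcal G_{p,q}$ can be written as $$M=U\Sigma V^\dagger,\qquad U,V\in \mathrm G\mathcal G_{p,q},\quad \Sigma\in K.$$ -/

import Mathlib

namespace GA

noncomputable section

/-- The diagonal entry `η_aa` of the signature: `1` for the first `p` indices and `-1` for the
remaining `q`. -/
def eta (p q : ℕ) (a : Fin (p + q)) : ℝ := if (a : ℕ) < p then 1 else -1

/-- The diagonal quadratic form of signature `(p, q)` on `ℝ^(p+q)`. -/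
abbrev form (p q : ℕ) : QuadraticForm ℝ (Fin (p + q) → ℝ) :=
  QuadraticMap.weightedSumSquares ℝ (eta p q)

end

end GA

/-- The real Clifford (geometric) algebra `𝒢_{p,q}`. -/
abbrev GA (p q : ℕ) : Type := CliffordAlgebra (GA.form p q)

namespace GA

noncomputable section

/-- The generators `e_a`. -/
def gen (p q : ℕ) (a : Fin (p + q)) : GA p q := CliffordAlgebra.ι (form p q) (Pi.single a 1)

/-- The basis element `e_A = e_{a₁} e_{a₂} ⋯ e_{a_k}` for `A = {a₁ < a₂ < ⋯ < a_k}`;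
in particular `e_∅ = e` is the identity. -/
def blade (p q : ℕ) (A : Finset (Fin (p + q))) : GA p q :=
  ((A.sort (· ≤ ·)).map (gen p q)).prod

theorem blade_empty (p q : ℕ) : blade p q ∅ = 1 := by simp [blade]

theorem gen_mul_self (p q : ℕ) (a : Fin (p + q)) :
    gen p q a * gen p q a = algebraMap ℝ (GA p q) (eta p q a) := by
  rw [gen, CliffordAlgebra.ι_sq_scalar]
  congr 1
  rw [QuadraticMap.weightedSumSquares_apply, Finset.sum_eq_single a]
  · simp
  · intro b _ hb
    simp [Pi.single_eq_of_ne hb]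
  · simp

theorem form_isOrtho (p q : ℕ) {a b : Fin (p + q)} (h : a ≠ b) :
    (form p q).IsOrtho (Pi.single a 1) (Pi.single b 1) := by
  rw [QuadraticMap.isOrtho_def]
  simp only [form, QuadraticMap.weightedSumSquares_apply, ← Finset.sum_add_distrib]
  refine Finset.sum_congr rfl fun i _ => ?_
  by_cases hi : i = a
  · subst hi
    simp [h]
  · simp [Pi.single_eq_of_ne hi]

theorem gen_anticomm (p q : ℕ) {a b : Fin (p + q)} (h : a ≠ b) :
    gen p q a * gen p q b + gen p q b * gen p q a = 0 :=
  CliffordAlgebra.ι_mul_ι_add_swap_of_isOrtho (form_isOrtho p q h)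

theorem isUnit_gen (p q : ℕ) (a : Fin (p + q)) : IsUnit (gen p q a) := by
  have h : IsUnit (gen p q a * gen p q a) := by
    rw [gen_mul_self]
    refine IsUnit.map _ (IsUnit.mk0 _ ?_)
    unfold eta
    split_ifs <;> norm_num
  exact ((Commute.refl _).isUnit_mul_iff.1 h).1

theorem isUnit_blade (p q : ℕ) (A : Finset (Fin (p + q))) : IsUnit (blade p q A) := by
  unfold blade
  induction A.sort (· ≤ ·) with
  | nil => simp
  | cons a l ih => simpa using (isUnit_gen p q a).mul ih

theorem contractLeft_prod_eq_zero {R M : Type*} [CommRing R] [AddCommGroup M] [Module R M]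
    (Q : QuadraticForm R M) (d : Module.Dual R M) (l : List M) (h : ∀ m ∈ l, d m = 0) :
    CliffordAlgebra.contractLeft d (l.map (CliffordAlgebra.ι Q)).prod = 0 := by
  induction l with
  | nil => simp
  | cons m l ih =>
    rw [List.map_cons, List.prod_cons, CliffordAlgebra.contractLeft_ι_mul,
      h m (by simp), ih fun m' hm' => h m' (by simp [hm'])]
    simp

theorem changeForm_prod {R M : Type*} [CommRing R] [AddCommGroup M] [Module R M]
    {Q Q' : QuadraticForm R M} {B : LinearMap.BilinForm R M}
    (h : B.toQuadraticMap = Q' - Q) (l : List M) (hl : l.Pairwise fun m m' => B m m' = 0) :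
    CliffordAlgebra.changeForm h (l.map (CliffordAlgebra.ι Q)).prod =
      (l.map (CliffordAlgebra.ι Q')).prod := by
  induction l with
  | nil => simp
  | cons m l ih =>
    rw [List.pairwise_cons] at hl
    rw [List.map_cons, List.prod_cons, CliffordAlgebra.changeForm_ι_mul, ih hl.2,
      contractLeft_prod_eq_zero Q' (B m) l hl.1, sub_zero, List.map_cons, List.prod_cons]

theorem equivExterior_blade (p q : ℕ) (A : Finset (Fin (p + q))) :
    CliffordAlgebra.equivExterior (form p q) (blade p q A) =
      (Pi.basisFun ℝ (Fin (p + q))).ExteriorAlgebra A := by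
  have h1 : blade p q A = (((A.sort (· ≤ ·)).map fun a => (Pi.single a 1 : Fin (p + q) → ℝ)).map
      (CliffordAlgebra.ι (form p q))).prod := by
    rw [List.map_map]; rfl
  rw [h1, CliffordAlgebra.equivExterior, CliffordAlgebra.changeFormEquiv_apply, changeForm_prod,
    ExteriorAlgebra.basis_apply_ofCard (n := A.card) _ rfl, ExteriorAlgebra.ιMulti_family,
    ExteriorAlgebra.ιMulti_apply, ← Finset.listMap_orderEmbOfFin_finRange A rfl, List.map_map,
    List.map_map, List.ofFn_eq_map]
  · congr 1
    refine List.map_congr_left fun i _ => ?_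
    simp only [Function.comp_apply, Pi.basisFun_apply]
    rfl
  · rw [List.pairwise_map]
    refine (A.sort_nodup (· ≤ ·)).imp fun {a b} hab => ?_
    have := form_isOrtho p q hab
    rw [QuadraticMap.isOrtho_def] at this
    simp [QuadraticMap.associated_apply, this]

/-- The `e_A` form a basis of the real vector space `𝒢_{p,q}`. -/
def bladeBasis (p q : ℕ) : Module.Basis (Finset (Fin (p + q))) ℝ (GA p q) :=
  (Pi.basisFun ℝ (Fin (p + q))).ExteriorAlgebra.map
    (CliffordAlgebra.equivExterior (form p q)).symm

theorem bladeBasis_apply (p q : ℕ) (A : Finset (Fin (p + q))) :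
    bladeBasis p q A = blade p q A := by
  rw [bladeBasis, Module.Basis.map_apply, ← equivExterior_blade, LinearEquiv.symm_apply_apply]

/-- Hermitian conjugation: the linear map `∑ m_A e_A ↦ ∑ m_A (e_A)⁻¹`. -/
def dagger (p q : ℕ) : GA p q →ₗ[ℝ] GA p q :=
  (bladeBasis p q).constr ℝ fun A => Ring.inverse (blade p q A)

theorem dagger_sum (p q : ℕ) (m : Finset (Fin (p + q)) → ℝ) :
    dagger p q (∑ A, m A • blade p q A) = ∑ A, m A • Ring.inverse (blade p q A) := by
  simp only [map_sum, map_smul, dagger, ← bladeBasis_apply, Module.Basis.constr_basis]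

/-- The group `G𝒢_{p,q} = {U : U† U = e}`. -/
def unitaryGroup (p q : ℕ) : Set (GA p q) := {U | dagger p q U * U = 1}

/-- The size `d` of the matrices in the Cartan–Bott periodicity table, `n = p + q`
(all the exponents are exact divisions of natural numbers). -/
def matrixSize (p q : ℕ) : ℕ :=
  let r : ℤ := ((p : ℤ) - (q : ℤ)) % 8
  if r = 0 ∨ r = 2 then 2 ^ ((p + q) / 2)
  else if r = 1 then 2 ^ ((p + q + 1) / 2)
  else if r = 3 ∨ r = 5 ∨ r = 7 then 2 ^ ((p + q - 1) / 2)
  else 2 ^ ((p + q - 2) / 2)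

end

end GA

/-! The argument is the matrix SVD carried out with blades. Each blade squares to `1` or `-1`, and
two blades commute or anticommute. Hence `dagger` is an anti-involution fixing the blades of square
`1` and negating the others. The coefficient of `e` is a trace, and the blades are orthonormal for
`⟨x, y⟩ = scalarPart (x† y)`. The unitary group is therefore compact, and it contains the circles `c
+ s e_A` with `e_A² = -1`.

Two maximizations over compact sets of unitaries give the factorization. A maximizer of `scalarPart
(U† M)` makes `N = U† M` Hermitian (`exists_dagger_mul_selfadjoint`). Then, for commuting blades of
square `1`, maximizing `scalarPart (W† N W e_B)` one blade at a time conjugates `N` to some `X`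
commuting with all of them (`exists_unitary_conj_commute`). In each case stationarity along the
circles is exactly the required identity, coordinate by coordinate.

A Hermitian `X` only involves blades of square `1`, and an element commuting with `e_B` only
involves blades commuting with `e_B`. So if the commuting family is maximal, `X` lies in its span,
and any maximal family serves as the basis of `K`.

It remains to find a maximal family with exactly `d` members. Squares and commutation depend only on
parities of cardinalities, so this is a question about binary codes. Adjoining a self-dual code to a
maximal family keeps it maximal (`IsMaximalCommuting.sum`). The two-word code in signature `(1, 1)`
and the extended Hamming code reduce every signature to a definite one with `n < 8`, which is a
finite check. -/

set_option linter.unusedSectionVars false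

namespace GA

/-! ### Parity combinatorics of commuting families, and gluing along disjoint unions. -/

section MaximalCommuting

variable {ι κ : Type*} [DecidableEq ι] [DecidableEq κ]

/-- `e_A` squares to `1`, in a signature whose negative indices are given by `neg`. -/
def IsSquareOne (neg : ι → Bool) (A : Finset ι) : Prop :=
  Even (A.card.choose 2 + (A.filter (neg ·)).card)

/-- `e_A` and `e_B` commute. -/
def IsCommuting (A B : Finset ι) : Prop :=
  Even (A.card * B.card + (A ∩ B).card)

/-- A maximal set of pairwise commuting blades of square `1`. -/
structure IsMaximalCommuting (neg : ι → Bool) (S : Finset (Finset ι)) : Prop where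
  isSquareOne : ∀ A ∈ S, IsSquareOne neg A
  isCommuting : ∀ A ∈ S, ∀ B ∈ S, IsCommuting A B
  mem_of_isCommuting : ∀ A, IsSquareOne neg A → (∀ B ∈ S, IsCommuting A B) → A ∈ S

/-- A set of even, pairwise commuting blades of square `1` which contains every blade commuting
with it. -/
structure IsSelfDualCode (neg : ι → Bool) (C : Finset (Finset ι)) : Prop where
  even_card : ∀ A ∈ C, Even A.card
  isSquareOne : ∀ A ∈ C, IsSquareOne neg A
  isCommuting : ∀ A ∈ C, ∀ B ∈ C, IsCommuting A B
  mem_of_isCommuting : ∀ A, (∀ B ∈ C, IsCommuting A B) → A ∈ C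

theorem isSquareOne_empty (neg : ι → Bool) : IsSquareOne neg ∅ := by
  simp [IsSquareOne]

theorem isCommuting_empty_left (A : Finset ι) : IsCommuting ∅ A := by
  simp [IsCommuting]

theorem isCommuting_empty_right (A : Finset ι) : IsCommuting A ∅ := by
  simp [IsCommuting]

theorem IsMaximalCommuting.empty_mem {neg : ι → Bool} {S : Finset (Finset ι)}
    (h : IsMaximalCommuting neg S) : ∅ ∈ S :=
  h.mem_of_isCommuting ∅ (isSquareOne_empty neg) fun B _ => isCommuting_empty_left B

theorem IsSelfDualCode.empty_mem {neg : ι → Bool} {C : Finset (Finset ι)}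
    (h : IsSelfDualCode neg C) : ∅ ∈ C :=
  h.mem_of_isCommuting ∅ fun B _ => isCommuting_empty_left B

theorem isSquareOne_map (e : ι ≃ κ) {neg : ι → Bool} {neg' : κ → Bool}
    (h : ∀ i, neg' (e i) = neg i) (A : Finset ι) :
    IsSquareOne neg' (A.map e.toEmbedding) ↔ IsSquareOne neg A := by
  simp [IsSquareOne, Finset.filter_map, h]

theorem isCommuting_map (e : ι ≃ κ) (A B : Finset ι) :
    IsCommuting (A.map e.toEmbedding) (B.map e.toEmbedding) ↔ IsCommuting A B := by
  simp [IsCommuting, ← Finset.map_inter]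

theorem IsMaximalCommuting.map {neg : ι → Bool} {neg' : κ → Bool} {S : Finset (Finset ι)}
    (hS : IsMaximalCommuting neg S) (e : ι ≃ κ) (h : ∀ i, neg' (e i) = neg i) :
    IsMaximalCommuting neg' (S.map (Finset.mapEmbedding e.toEmbedding).toEmbedding) where
  isSquareOne := by
    simpa [isSquareOne_map e h] using hS.isSquareOne
  isCommuting := by
    simpa [isCommuting_map e] using hS.isCommuting
  mem_of_isCommuting A hA hc := by
    obtain ⟨A, rfl⟩ : ∃ A', A = A'.map e.toEmbedding :=
      ⟨A.map e.symm.toEmbedding, by ext; simp⟩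
    rw [isSquareOne_map e h] at hA
    simp only [Finset.mem_map, RelEmbedding.coe_toEmbedding, Finset.mapEmbedding_apply,
      forall_exists_index, and_imp, forall_apply_eq_imp_iff₂, isCommuting_map] at hc ⊢
    exact ⟨A, hS.mem_of_isCommuting A hA hc, rfl⟩

theorem IsSelfDualCode.map {neg : ι → Bool} {neg' : κ → Bool} {C : Finset (Finset ι)}
    (hC : IsSelfDualCode neg C) (e : ι ≃ κ) (h : ∀ i, neg' (e i) = neg i) :
    IsSelfDualCode neg' (C.map (Finset.mapEmbedding e.toEmbedding).toEmbedding) where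
  even_card := by
    simpa using hC.even_card
  isSquareOne := by
    simpa [isSquareOne_map e h] using hC.isSquareOne
  isCommuting := by
    simpa [isCommuting_map e] using hC.isCommuting
  mem_of_isCommuting A hc := by
    obtain ⟨A, rfl⟩ : ∃ A', A = A'.map e.toEmbedding :=
      ⟨A.map e.symm.toEmbedding, by ext; simp⟩
    simp only [Finset.mem_map, RelEmbedding.coe_toEmbedding, Finset.mapEmbedding_apply,
      forall_exists_index, and_imp, forall_apply_eq_imp_iff₂, isCommuting_map] at hc ⊢
    exact ⟨A, hC.mem_of_isCommuting A hc, rfl⟩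

theorem disjSum_inter_disjSum (A A' : Finset ι) (D D' : Finset κ) :
    A.disjSum D ∩ A'.disjSum D' = (A ∩ A').disjSum (D ∩ D') := by
  ext (x | x) <;> simp

theorem isCommuting_disjSum_iff (A A' : Finset ι) (D D' : Finset κ) :
    IsCommuting (A.disjSum D) (A'.disjSum D') ↔
      Even (A.card * A'.card + (A ∩ A').card + (D.card * D'.card + (D ∩ D').card) +
        (A.card * D'.card + D.card * A'.card)) := by
  rw [IsCommuting, disjSum_inter_disjSum]
  simp only [Finset.card_disjSum]
  ring_nf

/-- Vandermonde's identity for `choose 2` produces the cross term `A.card * D.card`, the number of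
transpositions between the two blocks. -/
theorem isSquareOne_disjSum_iff (neg : ι → Bool) (neg' : κ → Bool) (A : Finset ι) (D : Finset κ) :
    IsSquareOne (Sum.elim neg neg') (A.disjSum D) ↔
      Even (A.card.choose 2 + (A.filter (neg ·)).card +
        (D.card.choose 2 + (D.filter (neg' ·)).card) + A.card * D.card) := by
  have h : ((A.disjSum D).filter (Sum.elim neg neg' ·)) =
      (A.filter (neg ·)).disjSum (D.filter (neg' ·)) := by
    ext (x | x) <;> simp
  rw [IsSquareOne, h, Finset.card_disjSum, Finset.card_disjSum, Nat.add_choose_eq,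
    Finset.Nat.sum_antidiagonal_eq_sum_range_succ_mk]
  simp only [Finset.sum_range_succ, Finset.sum_range_zero, Nat.choose_zero_right,
    Nat.choose_one_right, Nat.sub_self, Nat.reduceSub, tsub_zero]
  ring_nf

theorem isCommuting_disjSum {A A' : Finset ι} {D D' : Finset κ} (hD : Even D.card)
    (hD' : Even D'.card) (h : IsCommuting D D') :
    IsCommuting (A.disjSum D) (A'.disjSum D') ↔ IsCommuting A A' := by
  unfold IsCommuting at h
  rw [isCommuting_disjSum_iff, IsCommuting, Nat.even_add, Nat.even_add (n := _ * _ + _)]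
  simp only [h, iff_def, Nat.even_add, Nat.even_mul, hD, hD', or_true, true_or, true_imp_iff]
  tauto

theorem isSquareOne_disjSum {neg : ι → Bool} {neg' : κ → Bool} {A : Finset ι} {D : Finset κ}
    (hD : Even D.card) (h : IsSquareOne neg' D) :
    IsSquareOne (Sum.elim neg neg') (A.disjSum D) ↔ IsSquareOne neg A := by
  unfold IsSquareOne at h
  rw [isSquareOne_disjSum_iff, IsSquareOne, Nat.even_add,
    Nat.even_add (n := _ + (Finset.filter _ D).card)]
  simp [h, hD]

/-- Adjoining a self-dual code to a maximal commuting set. -/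
theorem IsMaximalCommuting.sum {neg : ι → Bool} {neg' : κ → Bool} {S : Finset (Finset ι)}
    {C : Finset (Finset κ)} (hS : IsMaximalCommuting neg S) (hC : IsSelfDualCode neg' C) :
    IsMaximalCommuting (Sum.elim neg neg')
      ((S ×ˢ C).map Finset.sumEquiv.symm.toEquiv.toEmbedding) where
  isSquareOne := by
    simp only [Finset.mem_map, Finset.mem_product, Prod.exists, forall_exists_index, and_imp]
    rintro _ A D hA hD rfl
    exact (isSquareOne_disjSum (hC.even_card D hD) (hC.isSquareOne D hD)).2 (hS.isSquareOne A hA)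
  isCommuting := by
    simp only [Finset.mem_map, Finset.mem_product, Prod.exists, forall_exists_index, and_imp]
    rintro _ A D hA hD rfl _ A' D' hA' hD' rfl
    exact (isCommuting_disjSum (hC.even_card D hD) (hC.even_card D' hD')
      (hC.isCommuting D hD D' hD')).2 (hS.isCommuting A hA A' hA')
  mem_of_isCommuting X hX hc := by
    obtain ⟨⟨A, D⟩, rfl⟩ := Finset.sumEquiv.symm.surjective X
    simp only [Finset.mem_map, Finset.mem_product, Prod.exists, forall_exists_index, and_imp]
      at hc ⊢
    have hD : D ∈ C := by
      refine hC.mem_of_isCommuting D fun D' hD' => ?_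
      -- Testing against `∅ ⊔ D'` isolates `D`, because the cross term `|A| |D'|` is even.
      have h := hc _ ∅ D' hS.empty_mem hD' rfl
      have h' := hC.even_card D' hD'
      change IsCommuting (A.disjSum D) (Finset.disjSum ∅ D') at h
      rw [isCommuting_disjSum_iff] at h
      simpa [Nat.even_add, Nat.even_mul, h', IsCommuting] using h
    refine ⟨A, D, ⟨hS.mem_of_isCommuting A ?_ fun A' hA' => ?_, hD⟩, rfl⟩
    · exact (isSquareOne_disjSum (hC.even_card D hD) (hC.isSquareOne D hD)).1 hX
    · exact (isCommuting_disjSum (hC.even_card D hD) (by simp)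
        (isCommuting_empty_right D)).1 (hc _ A' ∅ hA' hC.empty_mem rfl)

end MaximalCommuting

/-! ### Subsets as bit masks, for verification by computation. -/

section Mask

/-- The subset of `Fin n` whose indicator function is the binary expansion of `k`. -/
def maskSet (n k : ℕ) : Finset (Fin n) := Finset.univ.filter fun i => k.testBit i

/-- The number of nonzero digits among the `n` lowest binary digits of a number. -/
def popCount : ℕ → ℕ → ℕ
  | 0, _ => 0
  | n + 1, k => k % 2 + popCount n (k / 2)

theorem card_maskSet (n k : ℕ) : (maskSet n k).card = popCount n k := by
  induction n generalizing k with
  | zero => rfl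
  | succ n ih =>
    rw [maskSet, Fin.card_filter_univ_succ, popCount, ← ih, maskSet]
    simp only [Fin.val_zero, Fin.val_succ, Nat.testBit_succ, Nat.testBit_zero, decide_eq_true_eq]
    obtain h | h := Nat.mod_two_eq_zero_or_one k <;> simp [h, add_comm]

theorem maskSet_inter (n j k : ℕ) : maskSet n j ∩ maskSet n k = maskSet n (j &&& k) := by
  ext i
  simp [maskSet]

theorem maskSet_injOn (n : ℕ) : Set.InjOn (maskSet n) {k | k < 2 ^ n} := by
  intro j hj k hk h
  refine Nat.eq_of_testBit_eq fun i => ?_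
  obtain hi | hi := lt_or_ge i n
  · have := Finset.ext_iff.1 h ⟨i, hi⟩
    simp only [maskSet, Finset.mem_filter, Finset.mem_univ, true_and] at this
    exact Bool.eq_iff_iff.2 this
  · rw [Nat.testBit_lt_two_pow (hj.trans_le (Nat.pow_le_pow_right two_pos hi)),
      Nat.testBit_lt_two_pow (hk.trans_le (Nat.pow_le_pow_right two_pos hi))]

theorem exists_eq_maskSet {n : ℕ} (A : Finset (Fin n)) : ∃ k < 2 ^ n, maskSet n k = A := by
  refine ⟨Nat.ofBits fun i => decide (i ∈ A), Nat.ofBits_lt_two_pow _, ?_⟩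
  ext i
  simp [maskSet, Nat.testBit_ofBits_lt]

/-- The blade of the mask `k` has square `1` in a definite signature, negative if `b`. -/
def maskSquareOne (n : ℕ) (b : Bool) (k : ℕ) : Prop :=
  ((popCount n k).choose 2 + bif b then popCount n k else 0) % 2 = 0

/-- The blades of the masks `j` and `k` commute. -/
def maskCommute (n j k : ℕ) : Prop :=
  (popCount n j * popCount n k + popCount n (j &&& k)) % 2 = 0

instance (n : ℕ) (b : Bool) (k : ℕ) : Decidable (maskSquareOne n b k) :=
  inferInstanceAs (Decidable (_ = _))

instance (n j k : ℕ) : Decidable (maskCommute n j k) := inferInstanceAs (Decidable (_ = _))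

theorem isSquareOne_maskSet (n : ℕ) (b : Bool) (k : ℕ) :
    IsSquareOne (fun _ => b) (maskSet n k) ↔ maskSquareOne n b k := by
  cases b <;> simp [IsSquareOne, maskSquareOne, card_maskSet, Nat.even_iff]

theorem isCommuting_maskSet (n j k : ℕ) :
    IsCommuting (maskSet n j) (maskSet n k) ↔ maskCommute n j k := by
  rw [IsCommuting, maskCommute, maskSet_inter, card_maskSet, card_maskSet, card_maskSet,
    Nat.even_iff]

/-- The bitwise sums of members of `l`. -/
def xorSpan (l : List ℕ) : List ℕ := l.sublists.map fun m => m.foldr (· ^^^ ·) 0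

theorem card_image_maskSet {n : ℕ} {C : List ℕ} (hlt : ∀ k ∈ C, k < 2 ^ n) (hC : C.Nodup) :
    (C.toFinset.image (maskSet n)).card = C.length := by
  rw [Finset.card_image_of_injOn, List.toFinset_card_of_nodup hC]
  exact (maskSet_injOn n).mono fun k hk => hlt k (List.mem_toFinset.1 hk)

theorem isMaximalCommuting_image_maskSet {n : ℕ} {b : Bool} {C : List ℕ}
    (hs : ∀ k ∈ C, maskSquareOne n b k) (hc : ∀ j ∈ C, ∀ k ∈ C, maskCommute n j k)
    (hm : ∀ k ∈ List.range (2 ^ n), maskSquareOne n b k → (∀ j ∈ C, maskCommute n k j) → k ∈ C) :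
    IsMaximalCommuting (fun _ => b) (C.toFinset.image (maskSet n)) where
  isSquareOne := by simpa [isSquareOne_maskSet] using hs
  isCommuting := by simpa [isCommuting_maskSet] using hc
  mem_of_isCommuting A hA h := by
    obtain ⟨k, hk, rfl⟩ := exists_eq_maskSet A
    refine Finset.mem_image_of_mem _ (List.mem_toFinset.2 (hm k (List.mem_range.2 hk)
      ((isSquareOne_maskSet n b k).1 hA) fun j hj => ?_))
    exact (isCommuting_maskSet n k j).1
      (h _ (Finset.mem_image_of_mem _ (List.mem_toFinset.2 hj)))

theorem isSelfDualCode_image_maskSet {n : ℕ} {b : Bool} {C : List ℕ}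
    (he : ∀ k ∈ C, popCount n k % 2 = 0) (hs : ∀ k ∈ C, maskSquareOne n b k)
    (hc : ∀ j ∈ C, ∀ k ∈ C, maskCommute n j k)
    (hm : ∀ k ∈ List.range (2 ^ n), (∀ j ∈ C, maskCommute n k j) → k ∈ C) :
    IsSelfDualCode (fun _ => b) (C.toFinset.image (maskSet n)) where
  even_card := by simpa [card_maskSet, Nat.even_iff] using he
  isSquareOne := by simpa [isSquareOne_maskSet] using hs
  isCommuting := by simpa [isCommuting_maskSet] using hc
  mem_of_isCommuting A h := by
    obtain ⟨k, hk, rfl⟩ := exists_eq_maskSet A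
    refine Finset.mem_image_of_mem _ (List.mem_toFinset.2 (hm k (List.mem_range.2 hk)
      fun j hj => ?_))
    exact (isCommuting_maskSet n k j).1
      (h _ (Finset.mem_image_of_mem _ (List.mem_toFinset.2 hj)))

end Mask

/-! ### Maximal commuting families of size `d` in every signature. -/

/-- In signature `(p, q)` there is a maximal set of `d` pairwise commuting blades of square `1`. -/
def HasMaximalCommuting (p q d : ℕ) : Prop :=
  ∃ S : Finset (Finset (Fin p ⊕ Fin q)), IsMaximalCommuting Sum.isRight S ∧ S.card = d

theorem HasMaximalCommuting.add {p q d a b c : ℕ} (h : HasMaximalCommuting p q d)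
    (C : Finset (Finset (Fin a ⊕ Fin b))) (hC : IsSelfDualCode Sum.isRight C) (hc : C.card = c) :
    HasMaximalCommuting (p + a) (q + b) (d * c) := by
  obtain ⟨S, hS, rfl⟩ := h
  refine ⟨_, (hS.sum hC).map ((Equiv.sumSumSumComm _ _ _ _).trans
    (Equiv.sumCongr finSumFinEquiv finSumFinEquiv)) ?_, ?_⟩
  · rintro ((i | i) | (i | i)) <;> rfl
  · rw [Finset.card_map, Finset.card_map, Finset.card_product, hc]

theorem hasMaximalCommuting_of_pos {n d : ℕ} (C : List ℕ)
    (hs : ∀ k ∈ C, maskSquareOne n false k) (hc : ∀ j ∈ C, ∀ k ∈ C, maskCommute n j k)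
    (hm : ∀ k ∈ List.range (2 ^ n),
      maskSquareOne n false k → (∀ j ∈ C, maskCommute n k j) → k ∈ C)
    (hlt : ∀ k ∈ C, k < 2 ^ n) (hC : C.Nodup) (hd : C.length = d) :
    HasMaximalCommuting n 0 d :=
  ⟨_, (isMaximalCommuting_image_maskSet hs hc hm).map (Equiv.sumEmpty _ _).symm fun _ => rfl,
    by rw [Finset.card_map, card_image_maskSet hlt hC, hd]⟩

theorem hasMaximalCommuting_of_neg {n d : ℕ} (C : List ℕ)
    (hs : ∀ k ∈ C, maskSquareOne n true k) (hc : ∀ j ∈ C, ∀ k ∈ C, maskCommute n j k)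
    (hm : ∀ k ∈ List.range (2 ^ n),
      maskSquareOne n true k → (∀ j ∈ C, maskCommute n k j) → k ∈ C)
    (hlt : ∀ k ∈ C, k < 2 ^ n) (hC : C.Nodup) (hd : C.length = d) :
    HasMaximalCommuting 0 n d :=
  ⟨_, (isMaximalCommuting_image_maskSet hs hc hm).map (Equiv.emptySum _ _).symm fun _ => rfl,
    by rw [Finset.card_map, card_image_maskSet hlt hC, hd]⟩

/-- In signature `(1, 1)` the product of the two generators squares to `1`, and it anticommutes with
each generator, so `{∅, univ}` is self-dual. -/
theorem HasMaximalCommuting.add_hyperbolic {p q d : ℕ} (h : HasMaximalCommuting p q d) :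
    HasMaximalCommuting (p + 1) (q + 1) (d * 2) := by
  refine h.add {∅, Finset.univ} ⟨?_, ?_, ?_, ?_⟩ (by decide +kernel)
  · decide +kernel
  all_goals simp only [IsSquareOne, IsCommuting]; decide +kernel

/-- The extended Hamming code. -/
def hammingCode : List ℕ := xorSpan [0b1111, 0b110011, 0b1010101, 0b11111111]

/-- All weights are `0`, `4` or `8`, so the blades square to `1` in either definite signature. -/
theorem isSelfDualCode_hammingCode (b : Bool) :
    IsSelfDualCode (fun _ => b) (hammingCode.toFinset.image (maskSet 8)) := by
  refine isSelfDualCode_image_maskSet (by decide +kernel) ?_ (by decide +kernel) (by decide +kernel)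
  cases b <;> decide +kernel

theorem card_hammingCode : (hammingCode.toFinset.image (maskSet 8)).card = 16 :=
  card_image_maskSet (by decide +kernel) (by decide +kernel)

theorem HasMaximalCommuting.add_eight_pos {p q d : ℕ} (h : HasMaximalCommuting p q d) :
    HasMaximalCommuting (p + 8) q (d * 16) :=
  h.add (b := 0) _ ((isSelfDualCode_hammingCode false).map (Equiv.sumEmpty _ _).symm fun _ => rfl)
    (by rw [Finset.card_map, card_hammingCode])

theorem HasMaximalCommuting.add_eight_neg {p q d : ℕ} (h : HasMaximalCommuting p q d) :
    HasMaximalCommuting p (q + 8) (d * 16) :=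
  h.add (a := 0) _ ((isSelfDualCode_hammingCode true).map (Equiv.emptySum _ _).symm fun _ => rfl)
    (by rw [Finset.card_map, card_hammingCode])

/-- Here a `k`-blade squares to `1` iff `k ≡ 0, 1 (mod 4)`. Each family is closed under symmetric
difference, hence given by generators; maximality is tested on all `2 ^ n` masks. -/
theorem hasMaximalCommuting_pos_lt_eight {n : ℕ} (hn : n < 8) :
    HasMaximalCommuting n 0 (matrixSize n 0) := by
  interval_cases n
  · exact hasMaximalCommuting_of_pos (xorSpan []) (by decide +kernel) (by decide +kernel) (by decide +kernel)
      (by decide +kernel) (by decide +kernel) (by decide +kernel)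
  · exact hasMaximalCommuting_of_pos (xorSpan [1]) (by decide +kernel) (by decide +kernel) (by decide +kernel)
      (by decide +kernel) (by decide +kernel) (by decide +kernel)
  · exact hasMaximalCommuting_of_pos (xorSpan [1]) (by decide +kernel) (by decide +kernel) (by decide +kernel)
      (by decide +kernel) (by decide +kernel) (by decide +kernel)
  · exact hasMaximalCommuting_of_pos (xorSpan [1]) (by decide +kernel) (by decide +kernel) (by decide +kernel)
      (by decide +kernel) (by decide +kernel) (by decide +kernel)
  · exact hasMaximalCommuting_of_pos (xorSpan [0b1111]) (by decide +kernel) (by decide +kernel) (by decide +kernel)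
      (by decide +kernel) (by decide +kernel) (by decide +kernel)
  · exact hasMaximalCommuting_of_pos (xorSpan [1, 0b11110]) (by decide +kernel) (by decide +kernel) (by decide +kernel)
      (by decide +kernel) (by decide +kernel) (by decide +kernel)
  · exact hasMaximalCommuting_of_pos (xorSpan [1, 0b11110]) (by decide +kernel) (by decide +kernel) (by decide +kernel)
      (by decide +kernel) (by decide +kernel) (by decide +kernel)
  · exact hasMaximalCommuting_of_pos (xorSpan [1, 0b11110, 0b1100110]) (by decide +kernel) (by decide +kernel) (by decide +kernel)
      (by decide +kernel) (by decide +kernel) (by decide +kernel)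

/-- Here the condition for square `1` is `k ≡ 0, 3 (mod 4)`. -/
theorem hasMaximalCommuting_neg_lt_eight {n : ℕ} (hn : n < 8) :
    HasMaximalCommuting 0 n (matrixSize 0 n) := by
  interval_cases n
  · exact hasMaximalCommuting_of_neg (xorSpan []) (by decide +kernel) (by decide +kernel) (by decide +kernel)
      (by decide +kernel) (by decide +kernel) (by decide +kernel)
  · exact hasMaximalCommuting_of_neg (xorSpan []) (by decide +kernel) (by decide +kernel) (by decide +kernel)
      (by decide +kernel) (by decide +kernel) (by decide +kernel)
  · exact hasMaximalCommuting_of_neg (xorSpan []) (by decide +kernel) (by decide +kernel) (by decide +kernel)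
      (by decide +kernel) (by decide +kernel) (by decide +kernel)
  · exact hasMaximalCommuting_of_neg (xorSpan [0b111]) (by decide +kernel) (by decide +kernel) (by decide +kernel)
      (by decide +kernel) (by decide +kernel) (by decide +kernel)
  · exact hasMaximalCommuting_of_neg (xorSpan [0b1111]) (by decide +kernel) (by decide +kernel) (by decide +kernel)
      (by decide +kernel) (by decide +kernel) (by decide +kernel)
  · exact hasMaximalCommuting_of_neg (xorSpan [0b1111, 0b10011]) (by decide +kernel) (by decide +kernel) (by decide +kernel)
      (by decide +kernel) (by decide +kernel) (by decide +kernel)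
  · exact hasMaximalCommuting_of_neg (xorSpan [0b1111, 0b110011, 0b10101]) (by decide +kernel) (by decide +kernel) (by decide +kernel)
      (by decide +kernel) (by decide +kernel) (by decide +kernel)
  · exact hasMaximalCommuting_of_neg (xorSpan [0b1111, 0b110011, 0b1010101, 0b1111111]) (by decide +kernel) (by decide +kernel) (by decide +kernel)
      (by decide +kernel) (by decide +kernel) (by decide +kernel)

theorem matrixSize_succ_succ (p q : ℕ) : matrixSize (p + 1) (q + 1) = matrixSize p q * 2 := by
  unfold matrixSize
  dsimp only
  have h : ((p + 1 : ℕ) : ℤ) - ((q + 1 : ℕ) : ℤ) = (p : ℤ) - q := by push_cast; ring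
  rw [h]
  split_ifs <;> rw [← pow_succ] <;> congr 1 <;> omega

theorem matrixSize_add_eight_left (p q : ℕ) : matrixSize (p + 8) q = matrixSize p q * 16 := by
  unfold matrixSize
  dsimp only
  have h : (((p + 8 : ℕ) : ℤ) - (q : ℤ)) % 8 = ((p : ℤ) - q) % 8 := by omega
  rw [h, show 16 = 2 ^ 4 by rfl]
  split_ifs <;> rw [← pow_add] <;> congr 1 <;> omega

theorem matrixSize_add_eight_right (p q : ℕ) : matrixSize p (q + 8) = matrixSize p q * 16 := by
  unfold matrixSize
  dsimp only
  have h : ((p : ℤ) - ((q + 8 : ℕ) : ℤ)) % 8 = ((p : ℤ) - q) % 8 := by omega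
  rw [h, show 16 = 2 ^ 4 by rfl]
  split_ifs <;> rw [← pow_add] <;> congr 1 <;> omega

theorem hasMaximalCommuting_pos (n : ℕ) : HasMaximalCommuting n 0 (matrixSize n 0) := by
  induction n using Nat.strong_induction_on with
  | _ n ih =>
    obtain hn | hn := lt_or_ge n 8
    · exact hasMaximalCommuting_pos_lt_eight hn
    · obtain ⟨n, rfl⟩ := Nat.exists_eq_add_of_le' hn
      rw [matrixSize_add_eight_left]
      exact (ih n (by omega)).add_eight_pos

theorem hasMaximalCommuting_neg (n : ℕ) : HasMaximalCommuting 0 n (matrixSize 0 n) := by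
  induction n using Nat.strong_induction_on with
  | _ n ih =>
    obtain hn | hn := lt_or_ge n 8
    · exact hasMaximalCommuting_neg_lt_eight hn
    · obtain ⟨n, rfl⟩ := Nat.exists_eq_add_of_le' hn
      rw [matrixSize_add_eight_right]
      exact (ih n (by omega)).add_eight_neg

/-- Removing pairs of opposite sign leads to a definite signature, where the period is eight. -/
theorem hasMaximalCommuting (p q : ℕ) : HasMaximalCommuting p q (matrixSize p q) := by
  induction p generalizing q with
  | zero => exact hasMaximalCommuting_neg q
  | succ p ih =>
    cases q with
    | zero => exact hasMaximalCommuting_pos (p + 1)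
    | succ q =>
      rw [matrixSize_succ_succ]
      exact (ih q).add_hyperbolic

theorem exists_isMaximalCommuting (p q : ℕ) :
    ∃ S : Finset (Finset (Fin (p + q))),
      IsMaximalCommuting (fun a : Fin (p + q) => decide (p ≤ (a : ℕ))) S ∧ S.card = matrixSize p q := by
  obtain ⟨S, hS, hd⟩ := hasMaximalCommuting p q
  refine ⟨_, hS.map finSumFinEquiv ?_, by rw [Finset.card_map, hd]⟩
  rintro (i | i)
  · simp [not_le.2 i.isLt]
  · simp

/-! ### Multiplication of blades up to sign. -/

noncomputable section

variable (p q : ℕ)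

theorem eta_eq (a : Fin (p + q)) : eta p q a = (-1) ^ (if p ≤ (a : ℕ) then 1 else 0) := by
  unfold eta
  by_cases h : (a : ℕ) < p
  · simp [h]
  · simp [h, not_lt.1 h]

/-- The product of the generators listed in `l`. -/
abbrev genProd (l : List (Fin (p + q))) : GA p q := (l.map (gen p q)).prod

/-- Each letter other than `a` contributes a sign, and the exponent has the parity of the number of
such letters. -/
theorem gen_mul_genProd (a : Fin (p + q)) (l : List (Fin (p + q))) :
    gen p q a * genProd p q l =
      (-1 : ℝ) ^ (l.length + l.count a) • (genProd p q l * gen p q a) := by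
  induction l with
  | nil => simp [genProd]
  | cons b l ih =>
    simp only [genProd, List.map_cons, List.prod_cons, List.length_cons] at ih ⊢
    by_cases h : b = a
    · subst h
      rw [List.count_cons_self, add_add_add_comm, pow_add, mul_assoc (gen p q b), ih,
        mul_smul_comm]
      simp
    · rw [← mul_assoc, eq_neg_of_add_eq_zero_left (gen_anticomm p q (Ne.symm h)), neg_mul,
        mul_assoc, ih, List.count_cons_of_ne h, add_right_comm, pow_succ, mul_smul_comm,
        mul_assoc]
      simp

theorem genProd_mul_genProd (l m : List (Fin (p + q))) :
    genProd p q l * genProd p q m =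
      (-1 : ℝ) ^ (l.length * m.length + (l.map fun a => m.count a).sum) •
        (genProd p q m * genProd p q l) := by
  induction l with
  | nil => simp [genProd]
  | cons a l ih =>
    have h := gen_mul_genProd p q a m
    simp only [genProd, List.map_cons, List.prod_cons, List.length_cons, List.sum_cons]
      at ih h ⊢
    rw [mul_assoc, ih, mul_smul_comm, ← mul_assoc, h, smul_mul_assoc, smul_smul, ← pow_add,
      mul_assoc]
    congr 2
    ring

/-- Moving the head of the second copy through the tail of the first costs one sign per letter;
these add up to `choose 2`. The rest comes from the squares of the generators. -/
theorem genProd_mul_self (l : List (Fin (p + q))) (hl : l.Nodup) :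
    genProd p q l * genProd p q l =
      (-1 : ℝ) ^ (l.length.choose 2 + l.countP fun a : Fin (p + q) => decide (p ≤ (a : ℕ))) • 1 := by
  induction l with
  | nil => simp [genProd]
  | cons a l ih =>
    have h := gen_mul_genProd p q a l
    rw [List.nodup_cons] at hl
    rw [List.count_eq_zero_of_not_mem hl.1, add_zero] at h
    have h2 : genProd p q l * gen p q a = (-1 : ℝ) ^ l.length • (gen p q a * genProd p q l) := by
      rw [h, smul_smul, ← mul_pow]; simp
    have h3 : genProd p q (a :: l) * genProd p q (a :: l) =
        gen p q a * (genProd p q l * gen p q a) * genProd p q l := by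
      simp [genProd, mul_assoc]
    rw [h3, h2, mul_smul_comm, ← mul_assoc, gen_mul_self, smul_mul_assoc, mul_assoc, ih hl.2,
      ← Algebra.smul_def, smul_smul, smul_smul, eta_eq, ← pow_add, ← pow_add, List.length_cons,
      List.countP_cons, Nat.choose_succ_succ' _ 1, Nat.choose_one_right]
    simp only [decide_eq_true_eq]
    congr 2
    ring

theorem blade_mul_self (A : Finset (Fin (p + q))) :
    blade p q A * blade p q A = (-1 : ℝ) ^
      (A.card.choose 2 + (A.filter fun a : Fin (p + q) => decide (p ≤ (a : ℕ))).card) • 1 := by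
  have h := genProd_mul_self p q _ (A.sort_nodup (· ≤ ·))
  rw [List.countP_eq_length_filter, ← List.toFinset_card_of_nodup
    ((A.sort_nodup (· ≤ ·)).filter _), List.toFinset_filter, Finset.sort_toFinset,
    Finset.length_sort] at h
  exact h

theorem blade_mul_comm_smul (A B : Finset (Fin (p + q))) :
    blade p q A * blade p q B =
      (-1 : ℝ) ^ (A.card * B.card + (A ∩ B).card) • (blade p q B * blade p q A) := by
  have h := genProd_mul_genProd p q (A.sort (· ≤ ·)) (B.sort (· ≤ ·))
  rw [Finset.length_sort, Finset.length_sort, ← List.sum_toFinset _ (A.sort_nodup (· ≤ ·)),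
    Finset.sort_toFinset] at h
  have h₂ : ∑ a ∈ A, (B.sort (· ≤ ·)).count a = (A ∩ B).card := by
    rw [Finset.card_eq_sum_ones (A ∩ B), ← Finset.sum_ite_mem]
    refine Finset.sum_congr rfl fun a _ => ?_
    rw [(B.sort_nodup (· ≤ ·)).count]
    simp
  rw [h₂] at h
  exact h

theorem genProd_perm {l m : List (Fin (p + q))} (h : l.Perm m) :
    genProd p q l = genProd p q m ∨ genProd p q l = -genProd p q m := by
  induction h with
  | nil => exact Or.inl rfl
  | cons a _ ih =>
    simp only [genProd, List.map_cons, List.prod_cons] at ih ⊢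
    rcases ih with ih | ih <;> simp [ih]
  | swap a b l =>
    by_cases h : a = b
    · exact Or.inl (by rw [h])
    · right
      simp only [genProd, List.map_cons, List.prod_cons]
      rw [← mul_assoc, eq_neg_of_add_eq_zero_right (gen_anticomm p q h), neg_mul, mul_assoc]
  | trans _ _ ih₁ ih₂ =>
    rcases ih₁ with ih₁ | ih₁ <;> rcases ih₂ with ih₂ | ih₂ <;> simp [ih₁, ih₂]

theorem exists_gen_mul_blade (a : Fin (p + q)) (B : Finset (Fin (p + q))) :
    ∃ C, gen p q a * blade p q B = blade p q C ∨ gen p q a * blade p q B = -blade p q C := by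
  by_cases ha : a ∈ B
  · refine ⟨B.erase a, ?_⟩
    have h : (B.sort (· ≤ ·)).Perm (a :: (B.erase a).sort (· ≤ ·)) := by
      refine (List.perm_ext_iff_of_nodup (B.sort_nodup _) ?_).2 fun x => ?_
      · simp [Finset.sort_nodup]
      · by_cases hx : x = a <;> simp [hx, ha]
    have h2 : gen p q a * genProd p q (a :: (B.erase a).sort (· ≤ ·)) =
        eta p q a • blade p q (B.erase a) := by
      simp only [genProd, List.map_cons, List.prod_cons]
      rw [← mul_assoc, gen_mul_self, ← Algebra.smul_def]
      rfl
    have h3 : eta p q a = 1 ∨ eta p q a = -1 := by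
      unfold eta; split_ifs <;> simp
    have h4 := genProd_perm p q h
    change blade p q B = _ ∨ blade p q B = _ at h4
    rcases h4 with h4 | h4 <;> rcases h3 with h3 | h3 <;> simp [h4, h2, h3]
  · refine ⟨insert a B, ?_⟩
    refine genProd_perm p q (l := a :: B.sort (· ≤ ·)) ?_
    refine (List.perm_ext_iff_of_nodup ?_ (Finset.sort_nodup _ _)).2 fun x => ?_
    · simp [ha, Finset.sort_nodup]
    · simp

theorem exists_blade_mul_blade (A B : Finset (Fin (p + q))) :
    ∃ C, blade p q A * blade p q B = blade p q C ∨ blade p q A * blade p q B = -blade p q C := by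
  change ∃ C, genProd p q (A.sort (· ≤ ·)) * blade p q B = blade p q C ∨
    genProd p q (A.sort (· ≤ ·)) * blade p q B = -blade p q C
  induction A.sort (· ≤ ·) with
  | nil => exact ⟨B, by simp [genProd]⟩
  | cons a l ih =>
    obtain ⟨C, hC⟩ := ih
    obtain ⟨D, hD⟩ := exists_gen_mul_blade p q a C
    refine ⟨D, ?_⟩
    rw [genProd, List.map_cons, List.prod_cons, mul_assoc]
    rcases hC with hC | hC <;> rcases hD with hD | hD <;> simp [hC, hD]

theorem blade_mul_self_eq_one_or (A : Finset (Fin (p + q))) :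
    blade p q A * blade p q A = 1 ∨ blade p q A * blade p q A = -1 := by
  rw [blade_mul_self]
  rcases neg_one_pow_eq_or ℝ (A.card.choose 2 + (A.filter fun a : Fin (p + q) => decide (p ≤ (a : ℕ))).card)
    with h | h <;> rw [h] <;> simp

theorem blade_mul_comm_or (A B : Finset (Fin (p + q))) :
    blade p q A * blade p q B = blade p q B * blade p q A ∨
      blade p q A * blade p q B = -(blade p q B * blade p q A) := by
  rw [blade_mul_comm_smul]
  rcases neg_one_pow_eq_or ℝ (A.card * B.card + (A ∩ B).card) with h | h <;> simp [h]

theorem repr_blade (A : Finset (Fin (p + q))) :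
    (bladeBasis p q).repr (blade p q A) = Finsupp.single A 1 := by
  rw [← bladeBasis_apply, Module.Basis.repr_self]

theorem blade_induction {P : GA p q → Prop} (hblade : ∀ A, P (blade p q A))
    (hadd : ∀ x y, P x → P y → P (x + y)) (hsmul : ∀ (c : ℝ) x, P x → P (c • x)) (x : GA p q) :
    P x := by
  have hx : x ∈ Submodule.span ℝ (Set.range (bladeBasis p q)) := by
    rw [Module.Basis.span_eq]; trivial
  induction hx using Submodule.span_induction with
  | mem x hx =>
    obtain ⟨A, rfl⟩ := hx
    rw [bladeBasis_apply]
    exact hblade A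
  | zero => simpa using hsmul 0 _ (hblade ∅)
  | add x y _ _ hx hy => exact hadd x y hx hy
  | smul c x _ hx => exact hsmul c x hx

theorem sum_repr_smul_blade (x : GA p q) :
    ∑ A, (bladeBasis p q).repr x A • blade p q A = x := by
  simpa only [bladeBasis_apply] using (bladeBasis p q).sum_repr x

/-! ### Hermitian conjugation as an anti-involution. -/

theorem dagger_blade (A : Finset (Fin (p + q))) :
    dagger p q (blade p q A) = Ring.inverse (blade p q A) := by
  rw [dagger, ← bladeBasis_apply, Module.Basis.constr_basis, bladeBasis_apply]

theorem dagger_blade_mul_blade (A : Finset (Fin (p + q))) :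
    dagger p q (blade p q A) * blade p q A = 1 := by
  rw [dagger_blade, Ring.inverse_mul_cancel _ (isUnit_blade p q A)]

theorem dagger_blade_of_mul_self_eq_one {A : Finset (Fin (p + q))}
    (h : blade p q A * blade p q A = 1) : dagger p q (blade p q A) = blade p q A := by
  refine (isUnit_blade p q A).mul_right_cancel ?_
  rw [dagger_blade_mul_blade, h]

theorem dagger_blade_of_mul_self_eq_neg_one {A : Finset (Fin (p + q))}
    (h : blade p q A * blade p q A = -1) : dagger p q (blade p q A) = -blade p q A := by
  refine (isUnit_blade p q A).mul_right_cancel ?_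
  rw [dagger_blade_mul_blade, neg_mul, h, neg_neg]

theorem dagger_one : dagger p q 1 = 1 := by
  rw [← blade_empty p q]
  exact dagger_blade_of_mul_self_eq_one p q (by simp [blade_empty])

/-- Since `e_A e_B` is a blade up to sign, both sides are left inverses of the same unit. -/
theorem dagger_blade_mul (A B : Finset (Fin (p + q))) :
    dagger p q (blade p q A * blade p q B) =
      dagger p q (blade p q B) * dagger p q (blade p q A) := by
  refine ((isUnit_blade p q A).mul (isUnit_blade p q B)).mul_right_cancel ?_
  rw [mul_assoc, ← mul_assoc (dagger p q (blade p q A)), dagger_blade_mul_blade, one_mul,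
    dagger_blade_mul_blade]
  obtain ⟨C, hC | hC⟩ := exists_blade_mul_blade p q A B
  · rw [hC, dagger_blade_mul_blade]
  · rw [hC, map_neg, neg_mul_neg, dagger_blade_mul_blade]

theorem dagger_mul (x y : GA p q) : dagger p q (x * y) = dagger p q y * dagger p q x := by
  induction x using blade_induction with
  | hblade A =>
    induction y using blade_induction with
    | hblade B => exact dagger_blade_mul p q A B
    | hadd y z hy hz => rw [mul_add, map_add, map_add, add_mul, hy, hz]
    | hsmul c y hy => rw [mul_smul_comm, map_smul, map_smul, smul_mul_assoc, hy]
  | hadd x z hx hz => rw [add_mul, map_add, map_add, mul_add, hx, hz]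
  | hsmul c x hx => rw [smul_mul_assoc, map_smul, map_smul, mul_smul_comm, hx]

theorem dagger_dagger (x : GA p q) : dagger p q (dagger p q x) = x := by
  induction x using blade_induction with
  | hblade A =>
    obtain h | h := blade_mul_self_eq_one_or p q A
    · rw [dagger_blade_of_mul_self_eq_one p q h, dagger_blade_of_mul_self_eq_one p q h]
    · rw [dagger_blade_of_mul_self_eq_neg_one p q h, map_neg,
        dagger_blade_of_mul_self_eq_neg_one p q h, neg_neg]
  | hadd x z hx hz => rw [map_add, map_add, hx, hz]
  | hsmul c x hx => rw [map_smul, map_smul, hx]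

/-! ### The trace and the inner product it defines. -/

/-- The scalar part, which is a trace. -/
def scalarPart : GA p q →ₗ[ℝ] ℝ := (bladeBasis p q).coord ∅

theorem scalarPart_one : scalarPart p q 1 = 1 := by
  rw [scalarPart, ← blade_empty p q, Module.Basis.coord_apply, repr_blade, Finsupp.single_eq_same]

theorem scalarPart_blade {A : Finset (Fin (p + q))} (h : A ≠ ∅) :
    scalarPart p q (blade p q A) = 0 := by
  rw [scalarPart, Module.Basis.coord_apply, repr_blade, Finsupp.single_eq_of_ne (Ne.symm h)]

theorem eq_of_blade_eq_or_neg {A B : Finset (Fin (p + q))}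
    (h : blade p q A = blade p q B ∨ blade p q A = -blade p q B) : A = B := by
  by_contra hAB
  have h' : (bladeBasis p q).repr (blade p q A) A = 0 := by
    rcases h with h | h <;> simp [h, repr_blade, hAB]
  simp [repr_blade] at h'

theorem scalarPart_blade_mul_blade {A B : Finset (Fin (p + q))} (h : A ≠ B) :
    scalarPart p q (blade p q A * blade p q B) = 0 := by
  obtain ⟨C, hC⟩ := exists_blade_mul_blade p q A B
  obtain rfl | hC' := eq_or_ne C ∅
  · refine absurd (eq_of_blade_eq_or_neg p q ?_) h
    rw [blade_empty] at hC
    obtain hB | hB := blade_mul_self_eq_one_or p q B <;> obtain hC | hC := hC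
    · exact Or.inl ((isUnit_blade p q B).mul_right_cancel (hC.trans hB.symm))
    · exact Or.inr ((isUnit_blade p q B).mul_right_cancel (by rw [hC, neg_mul, hB]))
    · exact Or.inr ((isUnit_blade p q B).mul_right_cancel (by rw [hC, neg_mul, hB, neg_neg]))
    · exact Or.inl ((isUnit_blade p q B).mul_right_cancel (hC.trans hB.symm))
  · rcases hC with hC | hC <;> simp [hC, scalarPart_blade p q hC']

theorem scalarPart_mul_comm (x y : GA p q) :
    scalarPart p q (x * y) = scalarPart p q (y * x) := by
  induction x using blade_induction with
  | hblade A =>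
    induction y using blade_induction with
    | hblade B =>
      obtain rfl | h := eq_or_ne A B
      · rfl
      · rw [scalarPart_blade_mul_blade p q h, scalarPart_blade_mul_blade p q h.symm]
    | hadd y z hy hz => rw [mul_add, map_add, add_mul, map_add, hy, hz]
    | hsmul c y hy => rw [mul_smul_comm, map_smul, smul_mul_assoc, map_smul, hy]
  | hadd x z hx hz => rw [add_mul, map_add, mul_add, map_add, hx, hz]
  | hsmul c x hx => rw [smul_mul_assoc, map_smul, mul_smul_comm, map_smul, hx]

theorem scalarPart_dagger (x : GA p q) : scalarPart p q (dagger p q x) = scalarPart p q x := by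
  induction x using blade_induction with
  | hblade A =>
    obtain h | h := blade_mul_self_eq_one_or p q A
    · rw [dagger_blade_of_mul_self_eq_one p q h]
    · rw [dagger_blade_of_mul_self_eq_neg_one p q h, map_neg, neg_eq_iff_add_eq_zero]
      obtain rfl | hA := eq_or_ne A ∅
      · have h' := congrArg (scalarPart p q) h
        rw [blade_empty, mul_one, map_neg, scalarPart_one] at h'
        norm_num at h'
      · rw [scalarPart_blade p q hA, add_zero]
  | hadd x z hx hz => rw [map_add, map_add, map_add, hx, hz]
  | hsmul c x hx => rw [map_smul, map_smul, map_smul, hx]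

/-- Orthonormality of the blades: coordinates become traces, which can be cycled and conjugated. -/
theorem scalarPart_dagger_blade_mul (A : Finset (Fin (p + q))) (x : GA p q) :
    scalarPart p q (dagger p q (blade p q A) * x) = (bladeBasis p q).repr x A := by
  induction x using blade_induction with
  | hblade B =>
    obtain rfl | h := eq_or_ne A B
    · rw [dagger_blade_mul_blade, scalarPart_one, repr_blade, Finsupp.single_eq_same]
    · rw [repr_blade, Finsupp.single_eq_of_ne h]
      obtain hA | hA := blade_mul_self_eq_one_or p q A
      · rw [dagger_blade_of_mul_self_eq_one p q hA, scalarPart_blade_mul_blade p q h]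
      · rw [dagger_blade_of_mul_self_eq_neg_one p q hA, neg_mul, map_neg,
          scalarPart_blade_mul_blade p q h, neg_zero]
  | hadd x z hx hz => rw [mul_add, map_add, map_add, Finsupp.add_apply, hx, hz]
  | hsmul c x hx => rw [mul_smul_comm, map_smul, map_smul, Finsupp.smul_apply, hx]

theorem scalarPart_dagger_mul_self (x : GA p q) :
    scalarPart p q (dagger p q x * x) = ∑ A, (bladeBasis p q).repr x A ^ 2 := by
  conv_lhs =>
    rw [← sum_repr_smul_blade p q x, map_sum, Finset.sum_mul, map_sum,
      sum_repr_smul_blade p q x]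
  refine Finset.sum_congr rfl fun A _ => ?_
  rw [map_smul, smul_mul_assoc, map_smul, scalarPart_dagger_blade_mul, smul_eq_mul, sq]

theorem repr_of_scalarPart_blade_mul {A : Finset (Fin (p + q))}
    (h : blade p q A * blade p q A = -1) {x : GA p q}
    (hx : scalarPart p q (blade p q A * x) = 0) : (bladeBasis p q).repr x A = 0 := by
  rw [← scalarPart_dagger_blade_mul, dagger_blade_of_mul_self_eq_neg_one p q h, neg_mul, map_neg,
    hx, neg_zero]

theorem repr_of_dagger_eq_neg {A : Finset (Fin (p + q))} (h : blade p q A * blade p q A = 1)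
    {x : GA p q} (hx : dagger p q x = -x) : (bladeBasis p q).repr x A = 0 := by
  have h' : (bladeBasis p q).repr (dagger p q x) A = (bladeBasis p q).repr x A := by
    rw [← scalarPart_dagger_blade_mul, ← scalarPart_dagger_blade_mul, ← dagger_mul,
      scalarPart_dagger, scalarPart_mul_comm, dagger_blade_of_mul_self_eq_one p q h]
  rw [hx, map_neg, Finsupp.neg_apply] at h'
  linarith

theorem repr_of_dagger_eq_self {A : Finset (Fin (p + q))} (h : blade p q A * blade p q A = -1)
    {x : GA p q} (hx : dagger p q x = x) : (bladeBasis p q).repr x A = 0 := by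
  have h' : (bladeBasis p q).repr (dagger p q x) A = -(bladeBasis p q).repr x A := by
    rw [← scalarPart_dagger_blade_mul, ← scalarPart_dagger_blade_mul, ← dagger_mul,
      scalarPart_dagger, scalarPart_mul_comm, dagger_blade_of_mul_self_eq_neg_one p q h, neg_mul,
      map_neg, neg_neg]
  rw [hx] at h'
  linarith

theorem dagger_eq_self {x : GA p q}
    (hx : ∀ A, blade p q A * blade p q A = -1 → scalarPart p q (blade p q A * x) = 0) :
    dagger p q x = x := by
  conv_lhs => rw [← sum_repr_smul_blade p q x, map_sum]
  conv_rhs => rw [← sum_repr_smul_blade p q x]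
  refine Finset.sum_congr rfl fun A _ => ?_
  obtain h | h := blade_mul_self_eq_one_or p q A
  · rw [map_smul, dagger_blade_of_mul_self_eq_one p q h]
  · rw [repr_of_scalarPart_blade_mul p q h (hx A h), zero_smul, map_zero]

theorem eq_zero_of_repr {x : GA p q} (h : ∀ A, (bladeBasis p q).repr x A = 0) : x = 0 := by
  rw [← sum_repr_smul_blade p q x]
  exact Finset.sum_eq_zero fun A _ => by rw [h A, zero_smul]

/-- The coordinates of an element commuting with `e_B` are supported on the blades commuting
with `e_B`. -/
theorem repr_of_commute {x : GA p q} {A B : Finset (Fin (p + q))} (hx : Commute x (blade p q B))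
    (h : ¬ Commute (blade p q A) (blade p q B)) : (bladeBasis p q).repr x A = 0 := by
  have h₁ : blade p q B * dagger p q (blade p q A) =
      -(dagger p q (blade p q A) * blade p q B) := by
    have h₂ := (blade_mul_comm_or p q B A).resolve_left fun h' => h h'.symm
    obtain hA | hA := blade_mul_self_eq_one_or p q A
    · rw [dagger_blade_of_mul_self_eq_one p q hA, h₂]
    · rw [dagger_blade_of_mul_self_eq_neg_one p q hA, mul_neg, h₂, neg_mul]
  -- Insert `e_B e_B†` and cycle the trace: `e_B` commutes with `x` but anticommutes with `e_A†`.
  have h₃ : scalarPart p q (dagger p q (blade p q A) * x) =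
      -scalarPart p q (dagger p q (blade p q A) * x) := by
    calc scalarPart p q (dagger p q (blade p q A) * x)
        = scalarPart p q (dagger p q (blade p q A) *
            (x * blade p q B * dagger p q (blade p q B))) := by
          rw [mul_assoc x, dagger_blade p q B, Ring.mul_inverse_cancel _ (isUnit_blade p q B),
            mul_one]
      _ = scalarPart p q (dagger p q (blade p q A) * blade p q B * x *
            dagger p q (blade p q B)) := by
          rw [hx.eq]; simp only [mul_assoc]
      _ = -scalarPart p q (dagger p q (blade p q B) * blade p q B *
            (dagger p q (blade p q A) * x)) := by
          rw [scalarPart_mul_comm, ← map_neg, mul_assoc (dagger p q (blade p q B)),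
            ← mul_assoc (blade p q B), h₁, neg_mul, mul_neg, neg_neg]
      _ = _ := by rw [dagger_blade_mul_blade, one_mul]
  rw [← scalarPart_dagger_blade_mul]
  linarith

/-! ### The unitary group and its compactness. -/

instance : Module.Finite ℝ (GA p q) := Module.Finite.of_basis (bladeBasis p q)

theorem mul_dagger_of_mem_unitaryGroup {U : GA p q} (hU : U ∈ unitaryGroup p q) :
    U * dagger p q U = 1 :=
  haveI : IsNoetherianRing (GA p q) := isNoetherian_of_tower ℝ inferInstance
  mul_eq_one_symm hU

theorem one_mem_unitaryGroup : (1 : GA p q) ∈ unitaryGroup p q := by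
  change dagger p q 1 * 1 = 1
  rw [dagger_one, mul_one]

theorem mul_mem_unitaryGroup {U V : GA p q} (hU : U ∈ unitaryGroup p q)
    (hV : V ∈ unitaryGroup p q) : U * V ∈ unitaryGroup p q := by
  change dagger p q (U * V) * (U * V) = 1
  rw [dagger_mul, mul_assoc, ← mul_assoc (dagger p q U), show dagger p q U * U = 1 from hU,
    one_mul]
  exact hV

/-- These circles through `1` are the variations used in both maximizations. -/
theorem rotation_mem_unitaryGroup {A : Finset (Fin (p + q))}
    (h : blade p q A * blade p q A = -1) {c s : ℝ} (hcs : c ^ 2 + s ^ 2 = 1) :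
    c • 1 + s • blade p q A ∈ unitaryGroup p q := by
  change dagger p q (c • 1 + s • blade p q A) * (c • 1 + s • blade p q A) = 1
  rw [map_add, map_smul, map_smul, dagger_one, dagger_blade_of_mul_self_eq_neg_one p q h]
  simp only [add_mul, mul_add, smul_mul_smul_comm, one_mul, mul_one, neg_mul, h, neg_neg, smul_neg]
  rw [mul_comm s c, add_assoc, neg_add_cancel_left, ← add_smul, ← sq, ← sq, hcs, one_smul]

/-- The elements of `𝒢_{p,q}` as coordinate vectors. -/
abbrev ofCoord : (Finset (Fin (p + q)) → ℝ) ≃ₗ[ℝ] GA p q := (bladeBasis p q).equivFun.symm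

theorem continuous_bilinear_diag {E F : Type*} [NormedAddCommGroup E] [NormedSpace ℝ E]
    [FiniteDimensional ℝ E] [NormedAddCommGroup F] [NormedSpace ℝ F] (f : E →ₗ[ℝ] E →ₗ[ℝ] F) :
    Continuous fun x => f x x := by
  have h : Continuous fun x => f.toContinuousBilinearMap x x := by fun_prop
  exact h

/-- The defining equations are polynomial in the coordinates, and the squared coordinates of a
unitary sum to `scalarPart (x† x) = 1`. -/
theorem isCompact_unitary_commuting (T : Set (GA p q)) :
    IsCompact {x | ofCoord p q x ∈ unitaryGroup p q ∧ ∀ t ∈ T, Commute (ofCoord p q x) t} := by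
  refine Metric.isCompact_of_isClosed_isBounded (IsClosed.inter ?_ ?_) ?_
  · let f : (Finset (Fin (p + q)) → ℝ) →ₗ[ℝ] (Finset (Fin (p + q)) → ℝ) →ₗ[ℝ]
        (Finset (Fin (p + q)) → ℝ) :=
      ((LinearMap.mul ℝ (GA p q)).compl₁₂ (dagger p q ∘ₗ (ofCoord p q).toLinearMap)
        (ofCoord p q).toLinearMap).compr₂ (ofCoord p q).symm.toLinearMap
    have h : {x | ofCoord p q x ∈ unitaryGroup p q} =
        (fun x => f x x) ⁻¹' {(ofCoord p q).symm 1} :=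
      Set.ext fun x => (ofCoord p q).symm.injective.eq_iff.symm
    change IsClosed {x | ofCoord p q x ∈ unitaryGroup p q}
    rw [h]
    exact isClosed_singleton.preimage (continuous_bilinear_diag f)
  · have h : {x | ∀ t ∈ T, Commute (ofCoord p q x) t} = ⋂ t ∈ T,
        {x | ((ofCoord p q).symm.toLinearMap ∘ₗ
          (LinearMap.mulRight ℝ t - LinearMap.mulLeft ℝ t) ∘ₗ (ofCoord p q).toLinearMap) x = 0} := by
      ext x
      simp only [Set.mem_ofPred_eq, Set.mem_iInter, LinearMap.comp_apply, LinearEquiv.coe_coe,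
        map_eq_zero_iff _ (ofCoord p q).symm.injective, LinearMap.sub_apply,
        LinearMap.mulRight_apply, LinearMap.mulLeft_apply, sub_eq_zero]
      rfl
    change IsClosed {x | ∀ t ∈ T, Commute (ofCoord p q x) t}
    rw [h]
    exact isClosed_biInter fun t _ => isClosed_eq
      (LinearMap.continuous_of_finiteDimensional _) continuous_const
  · refine (Metric.isBounded_closedBall (x := 0) (r := 1)).subset fun x hx => ?_
    rw [mem_closedBall_zero_iff, pi_norm_le_iff_of_nonneg zero_le_one]
    intro A
    have h := scalarPart_dagger_mul_self p q (ofCoord p q x)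
    rw [show dagger p q _ * _ = 1 from hx.1, scalarPart_one] at h
    have h₁ (B : Finset (Fin (p + q))) : (bladeBasis p q).repr (ofCoord p q x) B = x B := by
      rw [← Module.Basis.equivFun_apply, LinearEquiv.apply_symm_apply]
    simp only [h₁] at h
    rw [Real.norm_eq_abs, ← sq_le_one_iff_abs_le_one, h]
    exact Finset.single_le_sum (f := fun B => x B ^ 2) (fun B _ => sq_nonneg _)
      (Finset.mem_univ A)

theorem exists_unitary_forall_le (T : Set (GA p q)) {f : GA p q → ℝ}
    (hf : Continuous (f ∘ ofCoord p q)) :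
    ∃ U ∈ unitaryGroup p q, (∀ t ∈ T, Commute U t) ∧
      ∀ W ∈ unitaryGroup p q, (∀ t ∈ T, Commute W t) → f W ≤ f U := by
  obtain ⟨x, hx, hmax⟩ := (isCompact_unitary_commuting p q T).exists_isMaxOn
    ⟨(ofCoord p q).symm 1, by simp [one_mem_unitaryGroup]⟩ hf.continuousOn
  refine ⟨_, hx.1, hx.2, fun W hW hWT => ?_⟩
  obtain ⟨y, rfl⟩ := (ofCoord p q).surjective W
  exact hmax ⟨hW, hWT⟩

/-! ### Stationarity, polar decomposition and simultaneous diagonalization. -/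

/-- If `a` is the maximum of a quadratic form on the unit circle, attained at `(1, 0)`, then the
mixed coefficient vanishes. -/
theorem eq_zero_of_forall_circle_le {a b d : ℝ}
    (h : ∀ c s : ℝ, c ^ 2 + s ^ 2 = 1 → c ^ 2 * a + c * s * b + s ^ 2 * d ≤ a) : b = 0 := by
  have key (t : ℝ) : t * b ≤ t ^ 2 * (a - d) := by
    have ht : 0 < 1 + t ^ 2 := by positivity
    have hr : √(1 + t ^ 2) ≠ 0 := (Real.sqrt_pos.2 ht).ne'
    have hsq : √(1 + t ^ 2) ^ 2 = 1 + t ^ 2 := Real.sq_sqrt ht.le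
    have h' := h (1 / √(1 + t ^ 2)) (t / √(1 + t ^ 2)) (by
      rw [div_pow, div_pow, hsq]; field_simp)
    rw [div_mul_div_comm, ← sq, div_pow, div_pow, hsq] at h'
    have h'' : (a + t * b + t ^ 2 * d) / (1 + t ^ 2) ≤ a := by
      refine le_trans (le_of_eq ?_) h'
      ring
    rw [div_le_iff₀ ht] at h''
    linarith
  have hd : 0 < |a - d| + 1 := by positivity
  -- With this `t`, `t * b = t ^ 2 * (|a - d| + 1)`, which exceeds `t ^ 2 * (a - d)` unless `t = 0`.
  have h₁ := key (b / (|a - d| + 1))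
  have h₂ : (b / (|a - d| + 1)) ^ 2 * (a - d) ≤ (b / (|a - d| + 1)) ^ 2 * |a - d| := by
    gcongr; exact le_abs_self _
  have h₃ : b / (|a - d| + 1) * b = (b / (|a - d| + 1)) ^ 2 * (|a - d| + 1) := by
    field_simp
  have h₄ : (b / (|a - d| + 1)) ^ 2 ≤ 0 := by linarith
  have h₅ := pow_eq_zero_iff two_ne_zero |>.1 (le_antisymm h₄ (sq_nonneg _))
  exact (div_eq_zero_iff.1 h₅).resolve_right hd.ne'

theorem eq_zero_of_forall_circle_linear_le {a b : ℝ}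
    (h : ∀ c s : ℝ, c ^ 2 + s ^ 2 = 1 → c * a + s * b ≤ a) : b = 0 := by
  by_contra hb
  -- The normalized vector `(a, b)` attains `√(a² + b²)`, which is larger than `a`.
  have hn : 0 < a ^ 2 + b ^ 2 := by positivity
  have hr := Real.sqrt_pos.2 hn
  have hsq : √(a ^ 2 + b ^ 2) ^ 2 = a ^ 2 + b ^ 2 := Real.sq_sqrt hn.le
  have h₄ := h (a / √(a ^ 2 + b ^ 2)) (b / √(a ^ 2 + b ^ 2)) (by
    rw [div_pow, div_pow, hsq]; field_simp)
  have h₅ : a / √(a ^ 2 + b ^ 2) * a + b / √(a ^ 2 + b ^ 2) * b = √(a ^ 2 + b ^ 2) := by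
    field_simp
    rw [hsq]
  have h₆ : a < √(a ^ 2 + b ^ 2) := by
    refine Real.lt_sqrt_of_sq_lt ?_
    have : 0 < b ^ 2 := by positivity
    linarith
  linarith

/-- Polar decomposition. -/
theorem exists_dagger_mul_selfadjoint (M : GA p q) :
    ∃ U ∈ unitaryGroup p q, dagger p q (dagger p q U * M) = dagger p q U * M := by
  obtain ⟨U, hU, -, hmax⟩ := exists_unitary_forall_le p q ∅
    (f := scalarPart p q ∘ₗ LinearMap.mulRight ℝ M ∘ₗ dagger p q)
    (LinearMap.continuous_of_finiteDimensional
      ((scalarPart p q ∘ₗ LinearMap.mulRight ℝ M ∘ₗ dagger p q) ∘ₗ (ofCoord p q).toLinearMap))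
  refine ⟨U, hU, dagger_eq_self p q fun A hA => ?_⟩
  -- The conjugate of `c + s e_A` is `c - s e_A`, so the coefficient of `s` is the negative of the
  -- desired trace.
  rw [← neg_eq_zero]
  refine eq_zero_of_forall_circle_linear_le (a := scalarPart p q (dagger p q U * M))
    fun c s hcs => ?_
  have h := hmax _ (mul_mem_unitaryGroup p q hU (rotation_mem_unitaryGroup p q hA hcs)) (by simp)
  simp only [LinearMap.comp_apply, LinearMap.mulRight_apply, dagger_mul, map_add, map_smul,
    dagger_one, dagger_blade_of_mul_self_eq_neg_one p q hA, add_mul, smul_mul_assoc, one_mul,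
    neg_mul, smul_eq_mul, map_neg, smul_neg, mul_assoc] at h
  linarith

/-- Simultaneous diagonalization with respect to commuting blades of square `1`. -/
theorem exists_unitary_conj_commute {N : GA p q} (hN : dagger p q N = N)
    (S : Finset (Finset (Fin (p + q)))) (hS : ∀ A ∈ S, blade p q A * blade p q A = 1)
    (hc : ∀ A ∈ S, ∀ B ∈ S, Commute (blade p q A) (blade p q B)) :
    ∃ V ∈ unitaryGroup p q, ∀ A ∈ S, Commute (dagger p q V * N * V) (blade p q A) := by
  induction S using Finset.induction_on with
  | empty => exact ⟨1, one_mem_unitaryGroup p q, by simp⟩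
  | insert B S hB ih =>
    obtain ⟨V, hV, hVS⟩ := ih (fun A hA => hS A (Finset.mem_insert_of_mem hA))
      fun A hA A' hA' => hc A (Finset.mem_insert_of_mem hA) A' (Finset.mem_insert_of_mem hA')
    generalize hN' : dagger p q V * N * V = N' at hVS
    have hN'd : dagger p q N' = N' := by
      rw [← hN', dagger_mul, dagger_mul, dagger_dagger, hN, mul_assoc]
    let f : (Finset (Fin (p + q)) → ℝ) →ₗ[ℝ] (Finset (Fin (p + q)) → ℝ) →ₗ[ℝ] ℝ :=
      ((LinearMap.mul ℝ (GA p q)).compl₁₂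
        (LinearMap.mulRight ℝ N' ∘ₗ dagger p q ∘ₗ (ofCoord p q).toLinearMap)
        (LinearMap.mulRight ℝ (blade p q B) ∘ₗ (ofCoord p q).toLinearMap)).compr₂ (scalarPart p q)
    -- Only unitaries commuting with the earlier blades compete, so the commutation already achieved
    -- survives conjugation by `W`.
    obtain ⟨W, hW, hWS, hmax⟩ := exists_unitary_forall_le p q (blade p q '' S)
      (f := fun W => scalarPart p q (dagger p q W * N' * (W * blade p q B)))
      (continuous_bilinear_diag f)
    have hWd (A) (hA : A ∈ S) : Commute (dagger p q W) (blade p q A) := by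
      have h := congrArg (dagger p q) (hWS _ (Set.mem_image_of_mem _ hA)).eq
      rwa [dagger_mul, dagger_mul, dagger_blade_of_mul_self_eq_one p q
        (hS A (Finset.mem_insert_of_mem hA)), eq_comm] at h
    refine ⟨V * W, mul_mem_unitaryGroup p q hV hW, ?_⟩
    have hX : dagger p q (V * W) * N * (V * W) = dagger p q W * N' * W := by
      rw [← hN', dagger_mul]; simp only [mul_assoc]
    rw [hX]
    have hXS (A) (hA : A ∈ S) : Commute (dagger p q W * N' * W) (blade p q A) :=
      ((hWd A hA).mul_left (hVS A hA)).mul_left (hWS _ (Set.mem_image_of_mem _ hA))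
    have hXd : dagger p q (dagger p q W * N' * W) = dagger p q W * N' * W := by
      rw [dagger_mul, dagger_mul, dagger_dagger, hN'd, mul_assoc]
    generalize hXdef : dagger p q W * N' * W = X at hXS hXd
    refine fun A hA => (Finset.mem_insert.1 hA).elim (fun h => ?_) (hXS A)
    subst h
    have hsq := hS A hA
    -- The commutator is anti-Hermitian, which kills its coordinates on blades of square `1`. For
    -- `e_C² = -1`, either `e_C` commutes with `S` and its circle is an admissible variation, or
    -- commutation with a suitable `e_D` kills the coordinate.
    refine sub_eq_zero.1 (eq_zero_of_repr p q (x := X * blade p q A - blade p q A * X)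
      fun C => ?_)
    obtain hC | hC := blade_mul_self_eq_one_or p q C
    · refine repr_of_dagger_eq_neg p q hC ?_
      rw [map_sub, dagger_mul, dagger_mul, hXd, dagger_blade_of_mul_self_eq_one p q hsq, neg_sub]
    by_cases hCS : ∀ D ∈ S, Commute (blade p q C) (blade p q D)
    · refine repr_of_scalarPart_blade_mul p q hC (neg_eq_zero.1 (eq_zero_of_forall_circle_le
        (a := scalarPart p q (X * blade p q A))
        (d := -scalarPart p q (blade p q C * X * (blade p q C * blade p q A))) fun c s hcs => ?_))
      have h := hmax _ (mul_mem_unitaryGroup p q hW (rotation_mem_unitaryGroup p q hC hcs)) (by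
        rintro _ ⟨D, hD, rfl⟩
        exact (hWS _ (Set.mem_image_of_mem _ hD)).mul_left
          (((Commute.one_left _).smul_left c).add_left ((hCS D hD).smul_left s)))
      have h₁ (R : GA p q) : dagger p q (W * R) * N' * (W * R * blade p q A) =
          dagger p q R * X * (R * blade p q A) := by
        rw [← hXdef, dagger_mul]; simp only [mul_assoc]
      have h₂ : dagger p q W * N' * (W * blade p q A) = X * blade p q A := by
        rw [← hXdef]; simp only [mul_assoc]
      -- Cyclicity turns the mixed coefficient into minus the trace of `e_C` times the commutator.
      have h₃ := scalarPart_mul_comm p q X (blade p q C * blade p q A)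
      rw [h₁, h₂, map_add, map_smul, map_smul, dagger_one,
        dagger_blade_of_mul_self_eq_neg_one p q hC] at h
      simp only [add_mul, mul_add, mul_sub, smul_mul_assoc, mul_smul_comm, one_mul, neg_mul,
        map_add, map_sub, map_smul, map_neg, smul_eq_mul, mul_assoc, smul_neg] at h h₃ ⊢
      rw [h₃] at h
      linarith
    · push Not at hCS
      obtain ⟨D, hD, hCD⟩ := hCS
      refine repr_of_commute p q ?_ hCD
      have hAD := hc A hA D (Finset.mem_insert_of_mem hD)
      exact ((hXS D hD).mul_left hAD).sub_left (hAD.mul_left (hXS D hD))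

/-! ### From parities back to blades, and the decomposition. -/

theorem neg_one_pow_smul_eq_self_iff {x : GA p q} (hx : x ≠ 0) (k : ℕ) :
    (-1 : ℝ) ^ k • x = x ↔ Even k := by
  refine ⟨fun h => ?_, fun h => by rw [h.neg_one_pow, one_smul]⟩
  by_contra hk
  rw [(Nat.not_even_iff_odd.1 hk).neg_one_pow, neg_one_smul, neg_eq_iff_add_eq_zero,
    ← two_smul ℝ x, smul_eq_zero] at h
  exact hx (h.resolve_left two_ne_zero)

theorem blade_mul_self_eq_one_iff (A : Finset (Fin (p + q))) :
    blade p q A * blade p q A = 1 ↔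
      IsSquareOne (fun a : Fin (p + q) => decide (p ≤ (a : ℕ))) A := by
  rw [blade_mul_self, IsSquareOne, neg_one_pow_smul_eq_self_iff p q one_ne_zero]

theorem commute_blade_iff (A B : Finset (Fin (p + q))) :
    Commute (blade p q A) (blade p q B) ↔ IsCommuting A B := by
  rw [Commute, SemiconjBy, blade_mul_comm_smul, IsCommuting,
    neg_one_pow_smul_eq_self_iff]
  exact ((isUnit_blade p q B).mul (isUnit_blade p q A)).ne_zero

end

end GA

theorem theorem1 (p q : ℕ) :
    ∃ B : Finset (Finset (Fin (p + q))), B.card = GA.matrixSize p q ∧ ∅ ∈ B ∧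
      ∀ M : GA p q, ∃ U ∈ GA.unitaryGroup p q, ∃ V ∈ GA.unitaryGroup p q,
        ∃ S ∈ Submodule.span ℝ (GA.blade p q '' (B : Set (Finset (Fin (p + q))))),
          M = U * S * GA.dagger p q V := by
  obtain ⟨B, hB, hcard⟩ := GA.exists_isMaximalCommuting p q
  refine ⟨B, hcard, hB.empty_mem, fun M => ?_⟩
  obtain ⟨U, hU, hN⟩ := GA.exists_dagger_mul_selfadjoint p q M
  obtain ⟨V, hV, hc⟩ := GA.exists_unitary_conj_commute p q hN B
    (fun A hA => (GA.blade_mul_self_eq_one_iff p q A).2 (hB.isSquareOne A hA))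
    fun A hA A' hA' => (GA.commute_blade_iff p q A A').2 (hB.isCommuting A hA A' hA')
  -- With `N = U† M` and `X = V† N V`, one has `M = U N = (U V) X V†`.
  refine ⟨U * V, GA.mul_mem_unitaryGroup p q hU hV, V, hV,
    GA.dagger p q V * (GA.dagger p q U * M) * V, ?_, ?_⟩
  · have hd : GA.dagger p q (GA.dagger p q V * (GA.dagger p q U * M) * V) =
        GA.dagger p q V * (GA.dagger p q U * M) * V := by
      rw [GA.dagger_mul, GA.dagger_mul p q (GA.dagger p q V), hN, GA.dagger_dagger,
        mul_assoc (GA.dagger p q V)]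
    generalize GA.dagger p q V * (GA.dagger p q U * M) * V = X at hc hd
    rw [← GA.sum_repr_smul_blade p q X]
    refine Submodule.sum_mem _ fun A _ => ?_
    by_cases hA : A ∈ B
    · exact Submodule.smul_mem _ _ (Submodule.subset_span (Set.mem_image_of_mem _ hA))
    · rw [show (GA.bladeBasis p q).repr X A = 0 from ?_, zero_smul]
      · exact Submodule.zero_mem _
      -- Outside `B`, a blade of square `1` fails to commute with some member by maximality; one of
      -- square `-1` is excluded because `X` is Hermitian.
      obtain hsq | hsq := GA.blade_mul_self_eq_one_or p q A
      · have : ¬ ∀ C ∈ B, GA.IsCommuting A C := fun h =>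
          hA (hB.mem_of_isCommuting A ((GA.blade_mul_self_eq_one_iff p q A).1 hsq) h)
        push Not at this
        obtain ⟨C, hC, hAC⟩ := this
        exact GA.repr_of_commute p q (hc C hC) (mt (GA.commute_blade_iff p q A C).1 hAC)
      · exact GA.repr_of_dagger_eq_self p q hsq hd
  · have h₁ := GA.mul_dagger_of_mem_unitaryGroup p q hU
    have h₂ := GA.mul_dagger_of_mem_unitaryGroup p q hV
    calc M = U * (V * GA.dagger p q V) * GA.dagger p q U * M * (V * GA.dagger p q V) := by
          rw [h₂, mul_one, mul_one, h₁, one_mul]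
      _ = _ := by simp only [mul_assoc]
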